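/- Fix the following setting. For $\mathcal X\in\mathbb R^{n_1\times p\times n_3}$ and $\mathcal Y\in\mathbb R^{p\times n_2\times n_3}$ with frontal slices $\mathbf X^{(k)},\mathbf Y^{(k)}$, the tensor-tensor product $\mathcal X\diamond\mathcal Y\in\mathbb R^{n_1\times n_2\times n_3}$ has frontal slices $\sum_{k'=1}^{n_3}\mathbf X^{(k-k'+1)}\mathbf Y^{(k')}$, the superscript of $\mathbf X$ being read modulo $n_3$ in $\{1,\dots,n_3\}$; $\|\cdot\|_F$ is the Frobenius norm and $\|\mathcal B\|_0$ the number of nonzero entries of $\mathcal B$. For integers $n_1,n_2,n_3\ge 2$, $r,s\ge 0$ and a real number $b\ge 0$ let $$\mathfrak U(r,b,s)=\left\{\mathcal A\diamond\mathcal B:\ \mathcal A\in[0,1]^{n_1\times r\times n_3},\ \mathcal B\in[0,b]^{r\times n_2\times n_3},\ \|\mathcal B\|_0\le s\right\}.$$ Let $\Theta\subseteq\mathbb R$ contain all entries of all tensors in $\mathfrak U(r,b,s)$, and let $(p_x)_{x\in\Theta}$ be a family of probability distributions on $\mathbb R$ (given for instance by probability density functions or probability mass functions). Let $m$ be an integer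 with $1\le m\le n_1n_2n_3$. If $\mathcal X^*\in\mathfrak U(r,b,s)$ is the underlying tensor, one observes $(\Omega,\mathcal Y_\Omega)$, where the random set $\Omega\subseteq\{1,\dots,n_1\}\times\{1,\dots,n_2\}\times\{1,\dots,n_3\}$ contains each index independently with probability $\gamma=\frac{m}{n_1n_2n_3}$ and, given $\Omega$, the observations $\mathcal Y_{ijk}$, $(i,j,k)\in\Omega$, are independent with $\mathcal Y_{ijk}\sim p_{\mathcal X^*_{ijk}}$. An estimator $\widetilde{\mathcal X}$ is a measurable function of $(\Omega,\mathcal Y_\Omega)$ with values in $\mathbb R^{n_1\times n_2\times n_3}$. **Theorem.** There exist universal constants $C,\beta_c>0$ such that the following holds in the setting above. Suppose that for some $\nu>0$ the Kullback–Leibler divergence satisfies $$D(p_x\,\|\,p_y)\le\frac{1}{2\nu^2}(x-y)^2\qquad\text{for all }x,y\in\Theta,$$ and let $r\le\min\{n_1,n_2\}$ and $r\le s\le rn_2n_3$. Then $$\inf_{\widetilde{\mathcal X}}\ \sup_{\mathcal X^*\in\mathfrak U(r,b,s)}\frac{\mathbb E_{\Omega,\mathcal Y_\Omega}\|\widetilde{\mathcal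 X}-\mathcal X^*\|_F^2}{n_1n_2n_3}\ \ge\ C\min\left\{\Delta b^2,\ \beta_c^2\nu^2\left(\frac{s+rn_1n_3}{m}\right)\right\},\qquad \Delta=\min\left\{1,\frac{s}{n_2n_3}\right\},$$ where the infimum is over all estimators. -/

import Mathlib

open MeasureTheory ProbabilityTheory
open scoped ENNReal

noncomputable section

namespace TensorCompletion

/-- The index set of the entries of an `n₁ × n₂ × n₃` tensor. -/
abbrev Idx (n₁ n₂ n₃ : ℕ) : Type := Fin n₁ × Fin n₂ × Fin n₃

/-- Real third-order tensors of size `n₁ × n₂ × n₃`. -/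
abbrev Tensor (n₁ n₂ n₃ : ℕ) : Type := Idx n₁ n₂ n₃ → ℝ

/-- `Unfold`: the frontal slices `X⁽¹⁾, …, X⁽ⁿ³⁾` stacked in a block column
(rows are indexed by (slice, row in the slice)). -/
def unfold {n₁ n₂ n₃ : ℕ} (X : Tensor n₁ n₂ n₃) : Matrix (Fin n₃ × Fin n₁) (Fin n₂) ℝ :=
  Matrix.of fun p j => X (p.2, j, p.1)

/-- `Fold`: the inverse of `unfold`. -/
def fold {n₁ n₂ n₃ : ℕ} (M : Matrix (Fin n₃ × Fin n₁) (Fin n₂) ℝ) : Tensor n₁ n₂ n₃ :=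
  fun p => M (p.2.2, p.1) p.2.1

/-- `Circ`: the block circulant matrix whose first block column is `M`; its block in position
`(k, k')` is the block number `k - k'` (modulo `n₃`) of `M`. -/
def circ {n₁ n₂ n₃ : ℕ} (M : Matrix (Fin n₃ × Fin n₁) (Fin n₂) ℝ) :
    Matrix (Fin n₃ × Fin n₁) (Fin n₃ × Fin n₂) ℝ :=
  Matrix.of fun p q => M (p.1 - q.1, p.2) q.2

/-- The tensor-tensor product `Fold (Circ (Unfold X) * Unfold Y)`. -/
def tProd {n₁ n₂ n₃ n₄ : ℕ} (X : Tensor n₁ n₂ n₃) (Y : Tensor n₂ n₄ n₃) : Tensor n₁ n₄ n₃ :=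
  fold (circ (unfold X) * unfold Y)

/-- The squared Frobenius norm. -/
def frobSq {n₁ n₂ n₃ : ℕ} (X : Tensor n₁ n₂ n₃) : ℝ := ∑ p, X p ^ 2

/-- The set `𝔘(r, b, s)`: tensors `A ⋄ B` with `A` of size `n₁ × r × n₃` with entries in `[0, 1]`
and `B` of size `r × n₂ × n₃` with entries in `[0, b]` and at most `s` nonzero entries. -/
def candidates (n₁ n₂ n₃ r : ℕ) (b : ℝ) (s : ℕ) : Set (Tensor n₁ n₂ n₃) :=
  {X | ∃ (A : Tensor n₁ r n₃) (B : Tensor r n₂ n₃),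
    X = tProd A B ∧ (∀ p, 0 ≤ A p ∧ A p ≤ 1) ∧ (∀ p, 0 ≤ B p ∧ B p ≤ b) ∧ hammingNorm B ≤ s}

/-- The sample space: an observed location set `Ω` together with the vector `Y_Ω` of the
observed entries. -/
abbrev Obs (n₁ n₂ n₃ : ℕ) : Type := Σ Ω : Finset (Idx n₁ n₂ n₃), (Ω → ℝ)

/-- The probability of the location set `Ω` under the Bernoulli model: each index belongs to the
random set with probability `γ`, independently of the others. -/
def bernProb {n₁ n₂ n₃ : ℕ} (γ : ℝ) (Ω : Finset (Idx n₁ n₂ n₃)) : ℝ≥0∞ :=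
  ENNReal.ofReal (γ ^ Ω.card * (1 - γ) ^ (Ωᶜ).card)

/-- The joint law of `(Ω, Y_Ω)` when the underlying tensor is `X`: `Ω ∼ Bern(γ)`, and given `Ω` the
observed entries are independent, the one at the index `ω` with law `P (X ω)`. -/
def obsLaw {n₁ n₂ n₃ : ℕ} (P : ℝ → Measure ℝ) (γ : ℝ) (X : Tensor n₁ n₂ n₃) :
    Measure (Obs n₁ n₂ n₃) :=
  ∑ Ω : Finset (Idx n₁ n₂ n₃),
    bernProb γ Ω • (Measure.pi fun ω : Ω => P (X ω.1)).map (Sigma.mk Ω)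

/-- Estimators: measurable functions of the observation `(Ω, Y_Ω)` with tensor values. -/
abbrev Estimator (n₁ n₂ n₃ : ℕ) : Type :=
  {est : Obs n₁ n₂ n₃ → Tensor n₁ n₂ n₃ // Measurable est}

/-- The risk `E_{Ω, Y_Ω} ‖est - X‖_F² / (n₁ n₂ n₃)`, with values in `[0, ∞]`. -/
def risk {n₁ n₂ n₃ : ℕ} (P : ℝ → Measure ℝ) (γ : ℝ) (est : Estimator n₁ n₂ n₃)
    (X : Tensor n₁ n₂ n₃) : ℝ≥0∞ :=
  (∫⁻ o, ENNReal.ofReal (frobSq (est.1 o - X)) ∂(obsLaw P γ X)) / ((n₁ * n₂ * n₃ : ℕ) : ℝ≥0∞)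

/-- The minimax risk over a class of tensors: infimum over all estimators of the worst-case risk. -/
def minimaxRisk {n₁ n₂ n₃ : ℕ} (P : ℝ → Measure ℝ) (γ : ℝ) (U : Set (Tensor n₁ n₂ n₃)) : ℝ≥0∞ :=
  ⨅ est : Estimator n₁ n₂ n₃, ⨆ X ∈ U, risk P γ est X

end TensorCompletion

end

/-! ### Hellinger affinity and testing between product measures -/

namespace TensorCompletion

/-! Assouad's method on two hypercubes. A cube consists of tensors with entries `0` or `a` on a set
`S` and zero elsewhere, each bit being shown in at most `M` entries. When one bit is flipped, the
divergences of the observed entries add up, on average over `Ω`, to at most `γMa²/(2ν²)`. If `γMa² ≤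
ν²`, no estimator can identify the bit, and each entry of `S` costs order `a²`
(`le_lintegral_entry_add`, `ofReal_le_minimaxRisk`). The best height `a² = min(b², ν²/(γM))` gives a
risk of order `(|S|/N) a²`, where `N = n₁n₂n₃`.

One cube puts `s` bits into the sparse factor, and a 0-1 first factor repeats each of them about
`n₁/r'` times; this yields the term `ν²s/m`. The other puts `rn₁n₃` bits into the dense factor,
whose columns are copied by a second factor with at most one nonzero entry per lateral slice; this
yields `ν²rn₁n₃/m`. In both cubes `|S|/N` is at least of order `Δ`, and the larger of the two terms
is at least half of their sum.

Indistinguishability is measured by the Hellinger affinity `∫ √(dμ/dν) dν`: it is multiplicative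
over independent observations, controls testing errors, and is bounded below through the
Kullback-Leibler divergence. -/

/-- With `P` the product of the other factors, `(1 - h i)(1 - P) ≥ 0` gives `h i * P ≥ h i + P - 1`.
Used with Hellinger affinities as `h i`. -/
lemma one_sub_sum_le_prod {ι : Type*} (s : Finset ι) (x h : ι → ℝ) (hx : ∀ i, 1 - x i ≤ h i)
    (h0 : ∀ i, 0 ≤ h i) (h1 : ∀ i, h i ≤ 1) : 1 - ∑ i ∈ s, x i ≤ ∏ i ∈ s, h i := by
  classical
  induction s using Finset.induction_on with
  | empty => simp
  | insert i s hi ih =>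
    rw [Finset.sum_insert hi, Finset.prod_insert hi]
    have hp1 : ∏ j ∈ s, h j ≤ 1 := Finset.prod_le_one (fun j _ => h0 j) fun j _ => h1 j
    nlinarith [hx i, h0 i, h1 i, mul_nonneg (sub_nonneg.2 (h1 i)) (sub_nonneg.2 hp1)]

/-- Pointwise form of "squared Hellinger distance is at most KL": `(√x - 1)² ≤ klFun x`. For `x =
y²` it reduces to `log y ≥ 1 - 1/y`. The form without subtraction can be integrated in `ℝ≥0∞`. -/
lemma one_add_le_klFun_add_two_mul_sqrt {x : ℝ} (hx : 0 ≤ x) :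
    1 + x ≤ InformationTheory.klFun x + 2 * √x := by
  rw [InformationTheory.klFun_apply]
  rcases hx.eq_or_lt with rfl | hx
  · simp
  obtain ⟨y, hy, rfl⟩ : ∃ y : ℝ, 0 < y ∧ x = y ^ 2 :=
    ⟨√x, Real.sqrt_pos.2 hx, (Real.sq_sqrt hx.le).symm⟩
  rw [Real.sqrt_sq hy.le, Real.log_pow]
  have h := Real.one_sub_inv_le_log_of_pos hy
  have h2 : y ^ 2 * (1 - y⁻¹) ≤ y ^ 2 * Real.log y := by gcongr
  have h3 : y ^ 2 * (1 - y⁻¹) = y ^ 2 - y := by field_simp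
  push_cast
  linarith

variable {α : Type*} [MeasurableSpace α]

lemma lintegral_rpow_half_le (ν : Measure α) {f : α → ℝ≥0∞} (hf : Measurable f) :
    ∫⁻ x, f x ^ (1 / 2 : ℝ) ∂ν ≤ (∫⁻ x, f x ∂ν) ^ (1 / 2 : ℝ) * ν Set.univ ^ (1 / 2 : ℝ) := by
  have h := ENNReal.lintegral_mul_norm_pow_le (μ := ν) (f := f) (g := fun _ => 1)
    (p := 1 / 2) (q := 1 / 2) hf.aemeasurable aemeasurable_const (by norm_num) (by norm_num)
    (by norm_num)
  simpa using h

/-- Le Cam's inequality: the square of the Hellinger affinity bounds from below the sum of the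
error probabilities of a test. -/
lemma sq_affinity_le {μ ν : Measure α} [IsProbabilityMeasure μ] [IsProbabilityMeasure ν]
    {f : α → ℝ≥0∞} (hf : Measurable f) (hμ : μ = ν.withDensity f) {E : Set α}
    (hE : MeasurableSet E) :
    (∫⁻ x, f x ^ (1 / 2 : ℝ) ∂ν).toReal ^ 2 ≤ 2 * (μ.real E + ν.real Eᶜ) := by
  -- Cauchy-Schwarz on `A`, where `f` integrates to `μ A`.
  have key (A : Set α) (hA : MeasurableSet A) :
      ∫⁻ x in A, f x ^ (1 / 2 : ℝ) ∂ν ≤ ENNReal.ofReal (√(μ.real A) * √(ν.real A)) := by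
    refine (lintegral_rpow_half_le (ν.restrict A) hf).trans (le_of_eq ?_)
    rw [← withDensity_apply f hA, ← hμ, Measure.restrict_apply_univ, Real.sqrt_eq_rpow,
      Real.sqrt_eq_rpow, ENNReal.ofReal_mul (by positivity),
      ← ENNReal.ofReal_rpow_of_nonneg measureReal_nonneg (by norm_num),
      ← ENNReal.ofReal_rpow_of_nonneg measureReal_nonneg (by norm_num), ofReal_measureReal,
      ofReal_measureReal]
  -- On `E` the factor `√(ν E)` is dropped, on `Eᶜ` the factor `√(μ Eᶜ)`.
  have hsum : (∫⁻ x, f x ^ (1 / 2 : ℝ) ∂ν).toReal ≤ √(μ.real E) + √(ν.real Eᶜ) := by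
    refine ENNReal.toReal_le_of_le_ofReal (by positivity) ?_
    rw [← lintegral_add_compl _ hE]
    refine (add_le_add (key E hE) (key Eᶜ hE.compl)).trans ?_
    rw [← ENNReal.ofReal_add (by positivity) (by positivity)]
    refine ENNReal.ofReal_le_ofReal (add_le_add ?_ ?_)
    · exact mul_le_of_le_one_right (by positivity) (Real.sqrt_le_one.2 measureReal_le_one)
    · exact mul_le_of_le_one_left (by positivity) (Real.sqrt_le_one.2 measureReal_le_one)
  have h1 := Real.sq_sqrt (measureReal_nonneg (μ := μ) (s := E))
  have h2 := Real.sq_sqrt (measureReal_nonneg (μ := ν) (s := Eᶜ))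
  have h3 := pow_le_pow_left₀ ENNReal.toReal_nonneg hsum 2
  nlinarith [sq_nonneg (√(μ.real E) - √(ν.real Eᶜ))]

lemma affinity_le_one (μ ν : Measure α) [IsProbabilityMeasure μ] [IsProbabilityMeasure ν] :
    ∫⁻ x, μ.rnDeriv ν x ^ (1 / 2 : ℝ) ∂ν ≤ 1 := by
  refine (lintegral_rpow_half_le ν (Measure.measurable_rnDeriv μ ν)).trans ?_
  have h : ∫⁻ x, μ.rnDeriv ν x ∂ν ≤ 1 := (Measure.lintegral_rnDeriv_le).trans (by simp)
  simpa using ENNReal.rpow_le_one h (by norm_num : (0 : ℝ) ≤ 1 / 2)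

/-- Finite divergence forces `μ ≪ ν`, so the density has integral `1`. Integrating the pointwise
inequality then gives `2 ≤ κ + 2H`, with `H` the affinity. -/
lemma one_sub_le_affinity {μ ν : Measure α} [IsProbabilityMeasure μ] [IsProbabilityMeasure ν]
    {κ : ℝ} (hκ : 0 ≤ κ) (h : InformationTheory.klDiv μ ν ≤ ENNReal.ofReal κ) :
    1 - κ / 2 ≤ (∫⁻ x, μ.rnDeriv ν x ^ (1 / 2 : ℝ) ∂ν).toReal := by
  have hac : μ ≪ ν :=
    (InformationTheory.klDiv_ne_top_iff.1 (ne_top_of_le_ne_top ENNReal.ofReal_ne_top h)).1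
  have hpt : ∀ᵐ x ∂ν, 1 + μ.rnDeriv ν x ≤
      ENNReal.ofReal (InformationTheory.klFun (μ.rnDeriv ν x).toReal) +
        2 * μ.rnDeriv ν x ^ (1 / 2 : ℝ) := by
    filter_upwards [Measure.rnDeriv_ne_top μ ν] with x hx
    lift μ.rnDeriv ν x to NNReal using hx with y
    have hy := one_add_le_klFun_add_two_mul_sqrt y.2
    have hk := InformationTheory.klFun_nonneg y.2
    have := ENNReal.ofReal_le_ofReal hy
    rw [ENNReal.ofReal_add zero_le_one y.2, ENNReal.ofReal_add hk (by positivity),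
      ENNReal.ofReal_mul zero_le_two, Real.sqrt_eq_rpow,
      ← ENNReal.ofReal_rpow_of_nonneg y.2 (by norm_num)] at this
    simpa using this
  have hint := lintegral_mono_ae hpt
  have hm := Measure.measurable_rnDeriv μ ν
  rw [lintegral_add_right _ hm, lintegral_add_right _ (by fun_prop),
    Measure.lintegral_rnDeriv hac, ← InformationTheory.klDiv_eq_lintegral_klFun_of_ac hac,
    lintegral_const_mul _ (by fun_prop)] at hint
  have hle := affinity_le_one μ ν
  generalize ∫⁻ x, μ.rnDeriv ν x ^ (1 / 2 : ℝ) ∂ν = H at hint hle ⊢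
  have hH : H ≠ ⊤ := ne_top_of_le_ne_top ENNReal.one_ne_top hle
  have h4 : (2 : ℝ≥0∞) ≤ ENNReal.ofReal (κ + 2 * H.toReal) := by
    rw [ENNReal.ofReal_add hκ (by positivity), ENNReal.ofReal_mul zero_le_two,
      ENNReal.ofReal_toReal hH]
    calc (2 : ℝ≥0∞) = 1 + 1 := by norm_num
      _ ≤ _ := by simpa using hint
      _ ≤ _ := by simpa using add_le_add_left h (2 * H)
  have h5 := (ENNReal.le_ofReal_iff_toReal_le (by simp) (by positivity)).1 h4
  norm_num at h5
  linarith

section Product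

variable {ι : Type*} [Fintype ι] {X : ι → Type*} [∀ i, MeasurableSpace (X i)]

lemma lintegral_pi_prod (ν : ∀ i, Measure (X i)) [∀ i, IsProbabilityMeasure (ν i)]
    {f : ∀ i, X i → ℝ≥0∞} (hf : ∀ i, Measurable (f i)) :
    ∫⁻ y, ∏ i, f i (y i) ∂Measure.pi ν = ∏ i, ∫⁻ x, f i x ∂ν i := by
  refine (lintegral_prod_eq_prod_lintegral_of_indepFun Finset.univ
    (fun i (y : ∀ i, X i) => f i (y i)) (iIndepFun_pi fun i => (hf i).aemeasurable)
    fun i => (hf i).comp (measurable_pi_apply i)).trans ?_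
  exact Finset.prod_congr rfl fun i _ => (measurePreserving_eval ν i).lintegral_comp (hf i)

lemma pi_eq_withDensity {μ ν : ∀ i, Measure (X i)} [∀ i, IsProbabilityMeasure (μ i)]
    [∀ i, IsProbabilityMeasure (ν i)] (h : ∀ i, μ i ≪ ν i) :
    Measure.pi μ = (Measure.pi ν).withDensity fun y => ∏ i, (μ i).rnDeriv (ν i) (y i) := by
  refine Measure.pi_eq fun s hs => ?_
  have hs' : MeasurableSet (Set.univ.pi s) := MeasurableSet.univ_pi hs
  have hind : (Set.univ.pi s).indicator (fun y => ∏ i, (μ i).rnDeriv (ν i) (y i)) =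
      fun y => ∏ i, (s i).indicator ((μ i).rnDeriv (ν i)) (y i) := by
    funext y
    by_cases hy : y ∈ Set.univ.pi s
    · rw [Set.indicator_of_mem hy]
      exact Finset.prod_congr rfl fun i _ => (Set.indicator_of_mem (hy i trivial) _).symm
    · rw [Set.indicator_of_notMem hy]
      obtain ⟨i, hi⟩ : ∃ i, y i ∉ s i := by simpa [Set.mem_pi] using hy
      exact (Finset.prod_eq_zero (Finset.mem_univ i) (Set.indicator_of_notMem hi _)).symm
  rw [withDensity_apply _ hs', ← lintegral_indicator hs', hind,
    lintegral_pi_prod ν fun i => (Measure.measurable_rnDeriv _ _).indicator (hs i)]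
  refine Finset.prod_congr rfl fun i _ => ?_
  rw [lintegral_indicator (hs i), Measure.setLIntegral_rnDeriv (h i)]

/-- Testing between two product measures whose factors are close in Kullback-Leibler divergence. -/
lemma one_sub_sum_le_pi_add_pi_compl {μ ν : ∀ i, Measure (X i)} [∀ i, IsProbabilityMeasure (μ i)]
    [∀ i, IsProbabilityMeasure (ν i)] {κ : ι → ℝ} (hκ : ∀ i, 0 ≤ κ i)
    (h : ∀ i, InformationTheory.klDiv (μ i) (ν i) ≤ ENNReal.ofReal (κ i))
    {E : Set (∀ i, X i)} (hE : MeasurableSet E) :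
    (1 - ∑ i, κ i) / 2 ≤ (Measure.pi μ).real E + (Measure.pi ν).real Eᶜ := by
  have hac i : μ i ≪ ν i :=
    (InformationTheory.klDiv_ne_top_iff.1 (ne_top_of_le_ne_top ENNReal.ofReal_ne_top (h i))).1
  have hm : Measurable fun y : ∀ i, X i => ∏ i, (μ i).rnDeriv (ν i) (y i) :=
    Finset.measurable_prod _ fun i _ =>
      (Measure.measurable_rnDeriv _ _).comp (measurable_pi_apply i)
  have h1 := sq_affinity_le hm (pi_eq_withDensity hac) hE
  have h2 : ∫⁻ y, (∏ i, (μ i).rnDeriv (ν i) (y i)) ^ (1 / 2 : ℝ) ∂Measure.pi ν =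
      ∏ i, ∫⁻ x, (μ i).rnDeriv (ν i) x ^ (1 / 2 : ℝ) ∂ν i := by
    rw [← lintegral_pi_prod ν fun i => (Measure.measurable_rnDeriv (μ i) (ν i)).pow_const _]
    exact lintegral_congr fun y => (ENNReal.prod_rpow_of_nonneg (by norm_num)).symm
  rw [h2, ENNReal.toReal_prod] at h1
  have h3 := one_sub_sum_le_prod Finset.univ (fun i => κ i / 2)
    (fun i => (∫⁻ x, (μ i).rnDeriv (ν i) x ^ (1 / 2 : ℝ) ∂ν i).toReal)
    (fun i => one_sub_le_affinity (hκ i) (h i)) (fun i => ENNReal.toReal_nonneg)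
    (fun i => ENNReal.toReal_le_of_le_ofReal zero_le_one
      (by simpa using affinity_le_one (μ i) (ν i)))
  rw [← Finset.sum_div] at h3
  have hp : 0 ≤ (Measure.pi μ).real E + (Measure.pi ν).real Eᶜ := by positivity
  -- The product of affinities is at least `1 - ∑ κ / 2`, whose square is at least `1 - ∑ κ`. If `∑
  -- κ > 1` the claimed bound is negative.
  rcases le_total (∑ i, κ i) 1 with h4 | h4
  · nlinarith [pow_le_pow_left₀ (by linarith : 0 ≤ 1 - (∑ i, κ i) / 2) h3 2,
      sq_nonneg (∑ i, κ i)]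
  · linarith

end Product

end TensorCompletion

/-! ### Bernoulli sampling and the two-point bound -/

namespace TensorCompletion

section Bernoulli

variable {ι : Type*} [Fintype ι] [DecidableEq ι]

lemma sum_bernoulli (γ : ℝ) : ∑ Ω : Finset ι, γ ^ Ω.card * (1 - γ) ^ Ωᶜ.card = 1 := by
  have h := Finset.prod_add (fun _ : ι => γ) (fun _ => 1 - γ) Finset.univ
  simpa [Finset.compl_eq_univ_sdiff] using h.symm

lemma sum_bernoulli_mem (γ : ℝ) (i : ι) :
    ∑ Ω : Finset ι, γ ^ Ω.card * (1 - γ) ^ Ωᶜ.card * (if i ∈ Ω then 1 else 0) = γ := by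
  -- Replacing the weight `1 - γ` at `i` by `0` removes from the expansion exactly the sets that
  -- miss `i`.
  have h := Finset.prod_add (fun _ : ι => γ) (fun j => if j = i then 0 else 1 - γ) Finset.univ
  have h1 : ∏ j, (γ + if j = i then 0 else 1 - γ) = γ := by
    rw [Finset.prod_eq_single i (fun j _ hj => by simp [hj]) (by simp)]
    simp
  rw [h1, Finset.powerset_univ] at h
  refine Eq.trans (Finset.sum_congr rfl fun Ω _ => ?_) h.symm
  rw [Finset.prod_const, mul_assoc, ← Finset.compl_eq_univ_sdiff]
  congr 1
  by_cases hi : i ∈ Ω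
  · rw [if_pos hi, mul_one, ← Finset.prod_const]
    refine Finset.prod_congr rfl fun j hj => ?_
    rw [if_neg]
    rintro rfl
    exact Finset.mem_compl.1 hj hi
  · rw [if_neg hi, mul_zero]
    have h0 : ∏ j ∈ Ωᶜ, (if j = i then 0 else 1 - γ) = 0 :=
      Finset.prod_eq_zero (Finset.mem_compl.2 hi) (if_pos rfl)
    rw [h0]

lemma sum_bernoulli_sum (γ : ℝ) (κ : ι → ℝ) :
    ∑ Ω : Finset ι, γ ^ Ω.card * (1 - γ) ^ Ωᶜ.card * ∑ i ∈ Ω, κ i = γ * ∑ i, κ i := by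
  have h (Ω : Finset ι) : ∑ i ∈ Ω, κ i = ∑ i, (if i ∈ Ω then 1 else 0) * κ i := by
    simp
  rw [Finset.sum_congr rfl fun Ω _ => by rw [h Ω, Finset.mul_sum], Finset.sum_comm,
    Finset.mul_sum]
  refine Finset.sum_congr rfl fun i _ => ?_
  simp_rw [← mul_assoc]
  rw [← Finset.sum_mul, sum_bernoulli_mem]

end Bernoulli

variable {n₁ n₂ n₃ : ℕ}

lemma measurable_obs_mk (Ω : Finset (Idx n₁ n₂ n₃)) :
    Measurable (fun y => ⟨Ω, y⟩ : (Ω → ℝ) → Obs n₁ n₂ n₃) :=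
  measurable_iff_le_map.2 (iInf_le _ Ω)

lemma lintegral_obsLaw (P : ℝ → Measure ℝ) (γ : ℝ) (X : Tensor n₁ n₂ n₃)
    {g : Obs n₁ n₂ n₃ → ℝ≥0∞} (hg : Measurable g) :
    ∫⁻ o, g o ∂obsLaw P γ X =
      ∑ Ω, bernProb γ Ω * ∫⁻ y, g ⟨Ω, y⟩ ∂Measure.pi fun ω : Ω => P (X ω.1) := by
  rw [obsLaw, lintegral_finsetSum_measure]
  refine Finset.sum_congr rfl fun Ω _ => ?_
  rw [lintegral_smul_measure, lintegral_map hg (measurable_obs_mk Ω), smul_eq_mul]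

/-- Two-point lower bound for estimating a real number by `t` from an observation whose law is
`μ` if the number is `u` and `ν` if it is `v`. -/
lemma mul_le_lintegral_sq_add_lintegral_sq {α : Type*} [MeasurableSpace α] {μ ν : Measure α}
    [IsProbabilityMeasure μ] [IsProbabilityMeasure ν] {c : ℝ}
    (htest : ∀ E : Set α, MeasurableSet E → c ≤ μ.real E + ν.real Eᶜ)
    {t : α → ℝ} (ht : Measurable t) (u v : ℝ) :
    ENNReal.ofReal ((u - v) ^ 2 / 4 * c) ≤
      ∫⁻ x, ENNReal.ofReal ((t x - u) ^ 2) ∂μ + ∫⁻ x, ENNReal.ofReal ((t x - v) ^ 2) ∂ν := by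
  -- `E` is the event that `t` misses `u` by at least half the gap. Off `E`, since `(t - u)² + (t -
  -- v)² ≥ (u - v)²/2`, it is `v` that is missed by that much.
  set E : Set α := {x | (u - v) ^ 2 / 4 ≤ (t x - u) ^ 2}
  have hE : MeasurableSet E := measurableSet_le measurable_const (by fun_prop)
  have hlow (ρ : Measure α) [IsProbabilityMeasure ρ] (F : Set α) (hF : MeasurableSet F) (w : ℝ)
      (hw : ∀ x ∈ F, (u - v) ^ 2 / 4 ≤ (t x - w) ^ 2) :
      ENNReal.ofReal ((u - v) ^ 2 / 4 * ρ.real F) ≤ ∫⁻ x, ENNReal.ofReal ((t x - w) ^ 2) ∂ρ := by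
    rw [ENNReal.ofReal_mul (by positivity), ofReal_measureReal, ← setLIntegral_const]
    exact (setLIntegral_mono' hF fun x hx => ENNReal.ofReal_le_ofReal (hw x hx)).trans
      (setLIntegral_le_lintegral _ _)
  refine le_trans ?_ (add_le_add (hlow μ E hE u fun x hx => hx) (hlow ν Eᶜ hE.compl v ?_))
  · rw [← ENNReal.ofReal_add (by positivity) (by positivity), ← mul_add]
    exact ENNReal.ofReal_le_ofReal (by gcongr; exact htest E hE)
  · intro x hx
    have h1 : (t x - u) ^ 2 < (u - v) ^ 2 / 4 := not_le.1 hx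
    nlinarith [sq_nonneg ((t x - u) + (t x - v))]

/-- Two-point lower bound for one entry of a tensor. -/
lemma le_lintegral_entry_add {P : ℝ → Measure ℝ} [∀ x, IsProbabilityMeasure (P x)] {γ ν : ℝ}
    (hγ0 : 0 ≤ γ) (hγ1 : γ ≤ 1) {X Y : Tensor n₁ n₂ n₃}
    (hkl : ∀ p, InformationTheory.klDiv (P (X p)) (P (Y p)) ≤
      ENNReal.ofReal (1 / (2 * ν ^ 2) * (X p - Y p) ^ 2))
    (hsmall : γ * ∑ p, 1 / (2 * ν ^ 2) * (X p - Y p) ^ 2 ≤ 1 / 2)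
    (est : Estimator n₁ n₂ n₃) (p : Idx n₁ n₂ n₃) :
    ENNReal.ofReal ((X p - Y p) ^ 2 / 16) ≤
      ∫⁻ o, ENNReal.ofReal ((est.1 o p - X p) ^ 2) ∂obsLaw P γ X +
        ∫⁻ o, ENNReal.ofReal ((est.1 o p - Y p) ^ 2) ∂obsLaw P γ Y := by
  have hest : Measurable fun o => est.1 o p := (measurable_pi_apply p).comp est.2
  rw [lintegral_obsLaw _ _ _ (by fun_prop), lintegral_obsLaw _ _ _ (by fun_prop),
    ← Finset.sum_add_distrib]
  set κ : Idx n₁ n₂ n₃ → ℝ := fun p => 1 / (2 * ν ^ 2) * (X p - Y p) ^ 2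
  have hκ q : 0 ≤ κ q := by positivity
  -- For fixed `Ω` the testing bound is affine in `∑ i ∈ Ω, κ i`, so averaging over `Ω` only needs
  -- the mean `γ * ∑ κ`.
  have hΩ (Ω : Finset (Idx n₁ n₂ n₃)) :
      ENNReal.ofReal (γ ^ Ω.card * (1 - γ) ^ Ωᶜ.card *
        ((X p - Y p) ^ 2 / 4 * ((1 - ∑ i ∈ Ω, κ i) / 2))) ≤
      bernProb γ Ω * (∫⁻ y, ENNReal.ofReal ((est.1 ⟨Ω, y⟩ p - X p) ^ 2)
          ∂(Measure.pi fun ω : Ω => P (X ω.1))) +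
        bernProb γ Ω * (∫⁻ y, ENNReal.ofReal ((est.1 ⟨Ω, y⟩ p - Y p) ^ 2)
          ∂(Measure.pi fun ω : Ω => P (Y ω.1))) := by
    rw [← mul_add, ENNReal.ofReal_mul
      (mul_nonneg (pow_nonneg hγ0 _) (pow_nonneg (sub_nonneg.2 hγ1) _)), bernProb]
    gcongr
    have hm : Measurable fun y : Ω → ℝ => est.1 ⟨Ω, y⟩ p := hest.comp (measurable_obs_mk Ω)
    refine mul_le_lintegral_sq_add_lintegral_sq (fun E hE => ?_) hm (X p) (Y p)
    rw [← Finset.sum_coe_sort Ω κ]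
    exact one_sub_sum_le_pi_add_pi_compl (μ := fun ω : Ω => P (X ω.1))
      (ν := fun ω : Ω => P (Y ω.1)) (κ := fun ω : Ω => κ ω.1) (fun i => hκ i.1)
      (fun i => hkl i.1) hE
  refine le_trans ?_ (Finset.sum_le_sum fun Ω _ => hΩ Ω)
  -- Terms with `∑ i ∈ Ω, κ i > 1` may be negative, so `ENNReal.ofReal` is merely subadditive here;
  -- that is the direction needed.
  refine le_trans (ENNReal.ofReal_le_ofReal ?_) (Finset.le_sum_of_subadditive ENNReal.ofReal
    ENNReal.ofReal_zero.le (fun _ _ => ENNReal.ofReal_add_le) _ _)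
  have h1 : ∑ Ω : Finset (Idx n₁ n₂ n₃), γ ^ Ω.card * (1 - γ) ^ Ωᶜ.card *
      ((X p - Y p) ^ 2 / 4 * ((1 - ∑ i ∈ Ω, κ i) / 2)) =
      (X p - Y p) ^ 2 / 8 * (1 - γ * ∑ i, κ i) := by
    rw [← sum_bernoulli_sum, ← sum_bernoulli (ι := Idx n₁ n₂ n₃) γ, ← Finset.sum_sub_distrib,
      Finset.mul_sum]
    exact Finset.sum_congr rfl fun Ω _ => by rw [sum_bernoulli]; ring
  rw [h1]
  nlinarith [sq_nonneg (X p - Y p)]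

end TensorCompletion

/-! ### Assouad's lemma -/

namespace TensorCompletion

variable {n₁ n₂ n₃ : ℕ} {D : Type*}

/-- The tensor whose entry at `p ∈ S` is `a` or `0` according to the bit number `f p` of `θ`, and
whose entries outside `S` vanish. -/
def bitTensor (S : Finset (Idx n₁ n₂ n₃)) (f : Idx n₁ n₂ n₃ → D) (a : ℝ) (θ : D → Bool) :
    Tensor n₁ n₂ n₃ :=
  fun p => if p ∈ S ∧ θ (f p) = true then a else 0

/-- Flipping the bit number `d`. -/
def flipBit [DecidableEq D] (d : D) : Equiv.Perm (D → Bool) :=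
  Function.Involutive.toPerm (fun θ => Function.update θ d (!θ d)) fun θ => by simp

lemma flipBit_apply [DecidableEq D] (d e : D) (θ : D → Bool) :
    flipBit d θ e = if e = d then !θ d else θ e :=
  Function.update_apply ..

lemma sq_bitTensor_sub_flipBit [DecidableEq D] (S : Finset (Idx n₁ n₂ n₃))
    (f : Idx n₁ n₂ n₃ → D) (a : ℝ) (θ : D → Bool) (d : D) (p : Idx n₁ n₂ n₃) :
    (bitTensor S f a θ p - bitTensor S f a (flipBit d θ) p) ^ 2 =
      if p ∈ S ∧ f p = d then a ^ 2 else 0 := by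
  simp only [bitTensor, flipBit_apply]
  by_cases hp : p ∈ S <;> by_cases hd : f p = d <;> cases hθ : θ (f p) <;>
    simp_all

lemma lintegral_frobSq (μ : Measure (Obs n₁ n₂ n₃)) (est : Estimator n₁ n₂ n₃)
    (X : Tensor n₁ n₂ n₃) :
    ∫⁻ o, ENNReal.ofReal (frobSq (est.1 o - X)) ∂μ =
      ∑ p, ∫⁻ o, ENNReal.ofReal ((est.1 o p - X p) ^ 2) ∂μ := by
  have hest p : Measurable fun o => est.1 o p := (measurable_pi_apply p).comp est.2
  rw [← lintegral_finsetSum _ fun p _ => by fun_prop]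
  refine lintegral_congr fun o => ?_
  rw [frobSq, ENNReal.ofReal_sum_of_nonneg fun p _ => sq_nonneg _]
  rfl

/-- Assouad's lemma for the completion problem: a lower bound for the minimax risk over a class
that contains all tensors encoding an array of bits `D → Bool`, each bit being displayed in at most
`M` entries. -/
theorem ofReal_le_minimaxRisk [Fintype D] [DecidableEq D] {P : ℝ → Measure ℝ}
    [∀ x, IsProbabilityMeasure (P x)] {γ ν a M : ℝ} {Θ : Set ℝ} {U : Set (Tensor n₁ n₂ n₃)}
    (S : Finset (Idx n₁ n₂ n₃)) (f : Idx n₁ n₂ n₃ → D)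
    (hN : 0 < n₁ * n₂ * n₃) (hγ0 : 0 ≤ γ) (hγ1 : γ ≤ 1) (hν : 0 < ν)
    (hΘ : ∀ X ∈ U, ∀ p, X p ∈ Θ)
    (hkl : ∀ x ∈ Θ, ∀ y ∈ Θ, InformationTheory.klDiv (P x) (P y) ≤
      ENNReal.ofReal (1 / (2 * ν ^ 2) * (x - y) ^ 2))
    (hU : ∀ θ : D → Bool, bitTensor S f a θ ∈ U)
    (hM : ∀ d, ((S.filter fun p => f p = d).card : ℝ) ≤ M) (hsmall : γ * M * a ^ 2 ≤ ν ^ 2) :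
    ENNReal.ofReal (S.card * a ^ 2 / (32 * ((n₁ : ℝ) * n₂ * n₃))) ≤ minimaxRisk P γ U := by
  refine le_iInf fun est => ?_
  set R := ⨆ X ∈ U, risk P γ est X
  set g : Idx n₁ n₂ n₃ → (D → Bool) → ℝ≥0∞ := fun p θ =>
    ∫⁻ o, ENNReal.ofReal ((est.1 o p - bitTensor S f a θ p) ^ 2)
      ∂obsLaw P γ (bitTensor S f a θ)
  have hrisk θ : ∑ p, g p θ ≤ R * (n₁ * n₂ * n₃ : ℕ) := by
    have h : risk P γ est (bitTensor S f a θ) ≤ R := le_iSup₂_of_le _ (hU θ) le_rfl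
    rw [risk, lintegral_frobSq] at h
    exact (ENNReal.div_le_iff (by exact_mod_cast hN.ne') (ENNReal.natCast_ne_top _)).1 h
  -- The bit `f p` is flipped: the two tensors differ exactly on the fibre of `f p` in `S`, at most
  -- `M` entries, so the mean divergence is at most `γMa²/(2ν²) ≤ 1/2`.
  have hpair p (hp : p ∈ S) θ :
      ENNReal.ofReal (a ^ 2 / 16) ≤ g p θ + g p (flipBit (f p) θ) := by
    have h := le_lintegral_entry_add (P := P) (ν := ν) hγ0 hγ1
      (X := bitTensor S f a θ) (Y := bitTensor S f a (flipBit (f p) θ))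
      (fun q => hkl _ (hΘ _ (hU _) _) _ (hΘ _ (hU _) _)) ?_ est p
    · rw [sq_bitTensor_sub_flipBit, if_pos ⟨hp, rfl⟩] at h
      exact h
    · simp_rw [sq_bitTensor_sub_flipBit]
      rw [← Finset.mul_sum, ← Finset.sum_filter, Finset.sum_const, nsmul_eq_mul]
      have hcard : (Finset.univ.filter fun q => q ∈ S ∧ f q = f p) =
          S.filter fun q => f q = f p := by ext q; simp
      rw [hcard]
      have h1 : γ * (((S.filter fun q => f q = f p).card : ℝ) * a ^ 2) ≤ ν ^ 2 := by
        refine le_trans ?_ hsmall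
        rw [mul_assoc]
        gcongr
        exact hM (f p)
      calc _ = γ * (((S.filter fun q => f q = f p).card : ℝ) * a ^ 2) / (2 * ν ^ 2) := by ring
        _ ≤ ν ^ 2 / (2 * ν ^ 2) := by gcongr
        _ = 1 / 2 := by field_simp
  -- Flipping permutes the cube, so both terms of `hpair` have the same sum over `θ`. Each entry of
  -- `S` thus costs `a²/32` on average over `θ`.
  have hsum p (hp : p ∈ S) :
      (Fintype.card (D → Bool) : ℝ≥0∞) * ENNReal.ofReal (a ^ 2 / 16) ≤ 2 * ∑ θ, g p θ := by
    calc _ = ∑ _θ : D → Bool, ENNReal.ofReal (a ^ 2 / 16) := by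
          rw [Finset.sum_const, nsmul_eq_mul, Finset.card_univ]
      _ ≤ ∑ θ, (g p θ + g p (flipBit (f p) θ)) := Finset.sum_le_sum fun θ _ => hpair p hp θ
      _ = _ := by
          rw [Finset.sum_add_distrib, Equiv.sum_comp (flipBit (f p)) (g p), two_mul]
  have htot : (S.card : ℝ≥0∞) *
      ((Fintype.card (D → Bool) : ℝ≥0∞) * ENNReal.ofReal (a ^ 2 / 16)) ≤
      2 * ((Fintype.card (D → Bool) : ℝ≥0∞) * (R * (n₁ * n₂ * n₃ : ℕ))) := by
    calc _ = ∑ _p ∈ S, ((Fintype.card (D → Bool) : ℝ≥0∞) * ENNReal.ofReal (a ^ 2 / 16)) := by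
          rw [Finset.sum_const, nsmul_eq_mul]
      _ ≤ ∑ p ∈ S, 2 * ∑ θ, g p θ := Finset.sum_le_sum hsum
      _ ≤ ∑ p, 2 * ∑ θ, g p θ :=
          Finset.sum_le_sum_of_subset_of_nonneg (Finset.subset_univ S) fun _ _ _ => zero_le
      _ = 2 * ∑ θ, ∑ p, g p θ := by rw [← Finset.mul_sum, Finset.sum_comm]
      _ ≤ 2 * ∑ _θ : D → Bool, R * (n₁ * n₂ * n₃ : ℕ) := by
          gcongr with θ
          exact hrisk θ
      _ = _ := by rw [Finset.sum_const, nsmul_eq_mul, Finset.card_univ]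
  generalize R = R at htot ⊢
  induction R with
  | top => exact le_top
  | coe ρ =>
    have h1 := ENNReal.toReal_mono (by finiteness) htot
    simp only [ENNReal.toReal_mul, ENNReal.toReal_natCast, ENNReal.coe_toReal,
      ENNReal.toReal_ofNat, ENNReal.toReal_ofReal (show 0 ≤ a ^ 2 / 16 by positivity)] at h1
    have hK : (0 : ℝ) < Fintype.card (D → Bool) := by exact_mod_cast Fintype.card_pos
    have hN' : (0 : ℝ) < (n₁ : ℝ) * n₂ * n₃ := by exact_mod_cast hN
    rw [← ENNReal.ofReal_coe_nnreal]
    refine ENNReal.ofReal_le_ofReal ?_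
    rw [div_le_iff₀ (by positivity)]
    push_cast at h1
    refine le_of_mul_le_mul_left ?_ hK
    linarith

/-- `ofReal_le_minimaxRisk` with the optimal height of the bits. -/
theorem ofReal_le_minimaxRisk_of_forall_le [Fintype D] [DecidableEq D] {P : ℝ → Measure ℝ}
    [∀ x, IsProbabilityMeasure (P x)] {γ ν b M x : ℝ} {Θ : Set ℝ} {U : Set (Tensor n₁ n₂ n₃)}
    (S : Finset (Idx n₁ n₂ n₃)) (f : Idx n₁ n₂ n₃ → D)
    (hN : 0 < n₁ * n₂ * n₃) (hγ0 : 0 < γ) (hγ1 : γ ≤ 1) (hν : 0 < ν) (hb : 0 ≤ b)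
    (hΘ : ∀ X ∈ U, ∀ p, X p ∈ Θ)
    (hkl : ∀ x ∈ Θ, ∀ y ∈ Θ, InformationTheory.klDiv (P x) (P y) ≤
      ENNReal.ofReal (1 / (2 * ν ^ 2) * (x - y) ^ 2))
    (hU : ∀ a, 0 ≤ a → a ≤ b → ∀ θ : D → Bool, bitTensor S f a θ ∈ U) (hM0 : 0 < M)
    (hM : ∀ d, ((S.filter fun p => f p = d).card : ℝ) ≤ M)
    (hxb : x ≤ S.card * b ^ 2 / (32 * ((n₁ : ℝ) * n₂ * n₃)))
    (hxν : x ≤ S.card * (ν ^ 2 / (γ * M)) / (32 * ((n₁ : ℝ) * n₂ * n₃))) :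
    ENNReal.ofReal x ≤ minimaxRisk P γ U := by
  -- The largest height allowed by both `a ≤ b` (membership in the class) and `γMa² ≤ ν²`
  -- (indistinguishable neighbours).
  set a := √(min (b ^ 2) (ν ^ 2 / (γ * M)))
  have ha : a ^ 2 = min (b ^ 2) (ν ^ 2 / (γ * M)) := Real.sq_sqrt (by positivity)
  have hab : a ≤ b := Real.sqrt_le_iff.2 ⟨hb, min_le_left _ _⟩
  refine (ENNReal.ofReal_le_ofReal ?_).trans (ofReal_le_minimaxRisk (a := a) S f hN hγ0.le hγ1 hν
    hΘ hkl (hU a (Real.sqrt_nonneg _) hab) hM ?_)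
  · rw [ha]
    rcases min_choice (b ^ 2) (ν ^ 2 / (γ * M)) with h | h <;> rw [h] <;> assumption
  · rw [ha, mul_comm, ← le_div_iff₀ (by positivity)]
    exact min_le_right _ _

end TensorCompletion

/-! ### Realising bit tensors as sparse products -/

namespace TensorCompletion

variable {n₁ n₂ n₃ r : ℕ}

lemma tProd_apply {n₄ : ℕ} (A : Tensor n₁ r n₃) (B : Tensor r n₄ n₃) (p : Idx n₁ n₄ n₃) :
    tProd A B p = ∑ q : Fin n₃ × Fin r, A (p.1, q.2, p.2.2 - q.1) * B (q.2, p.2.1, q.1) := rfl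

/-- Stated through `val` because `n` may be `0`, in which case `Fin n` has no zero element. -/
lemma val_sub_eq_zero_iff {n : ℕ} (k l : Fin n) : (k - l).val = 0 ↔ l = k := by
  obtain _ | n := n
  · exact k.elim0
  · rw [Fin.val_eq_zero_iff, sub_eq_zero, eq_comm]

lemma sub_of_val_eq_zero {n : ℕ} (k l : Fin n) (h : l.val = 0) : k - l = k := by
  obtain _ | n := n
  · exact k.elim0
  · rw [Fin.val_eq_zero_iff.1 h, sub_zero]

lemma card_filter_mod_eq (n r l : ℕ) (hr : 0 < r) (hl : l < r) :
    (Finset.univ.filter fun i : Fin n => i.val % r = l).card =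
      n / r + if l < n % r then 1 else 0 := by
  have h := Nat.count_modEq_card n hr l
  rw [Nat.mod_eq_of_lt hl, Nat.count_eq_card_filter_range] at h
  rw [← h]
  refine Finset.card_nbij Fin.val (fun i hi => ?_) Fin.val_injective.injOn fun k hk => ?_
  · simpa [Nat.ModEq, Nat.mod_eq_of_lt hl] using hi
  · have hk' : k < n ∧ k % r = l := by simpa [Nat.ModEq, Nat.mod_eq_of_lt hl] using hk
    exact ⟨⟨k, hk'.1⟩, by simpa using hk'.2, rfl⟩

/-- A residue class has `⌊n/r⌋` or `⌊n/r⌋ + 1` elements, and `r ≤ n` keeps both within a factor two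
of `n/r`. -/
lemma card_filter_mod_le (n r l : ℕ) (hr : 0 < r) (hl : l < r) (hn : r ≤ n) :
    ((Finset.univ.filter fun i : Fin n => i.val % r = l).card : ℝ) ≤ 2 * n / r := by
  rw [card_filter_mod_eq n r l hr hl, le_div_iff₀ (by exact_mod_cast hr)]
  have h : (n / r + if l < n % r then 1 else 0) * r ≤ 2 * n := by
    have := Nat.div_mul_le_self n r
    split_ifs <;> nlinarith
  exact_mod_cast h

lemma le_card_filter_mod (n r l : ℕ) (hr : 0 < r) (hl : l < r) (hn : r ≤ n) :
    (n : ℝ) / (2 * r) ≤ (Finset.univ.filter fun i : Fin n => i.val % r = l).card := by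
  rw [card_filter_mod_eq n r l hr hl, div_le_iff₀ (by positivity)]
  have h : n ≤ (n / r + if l < n % r then 1 else 0) * (2 * r) := by
    have h1 := Nat.div_add_mod n r
    have h2 := Nat.mod_lt n hr
    have h3 := Nat.div_pos hn hr
    have h4 : r * 1 ≤ r * (n / r) := Nat.mul_le_mul_left r h3
    have h5 : n ≤ (n / r) * (2 * r) := by nlinarith
    split_ifs <;> nlinarith
  exact_mod_cast h

/-- Bits placed in the second factor are displayed in a tensor product with a `0`-`1` first factor
that repeats its first `r'` rows. -/
lemma bitTensor_mem_candidates_right {r' s : ℕ} {a b : ℝ} (hr' : 0 < r') (hr : r' ≤ r)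
    (T : Finset (Idx r n₂ n₃)) (hT : T.card ≤ s) (ha : 0 ≤ a) (hab : a ≤ b)
    (θ : Idx r n₂ n₃ → Bool) :
    let f : Idx n₁ n₂ n₃ → Idx r n₂ n₃ := fun p =>
      (⟨p.1.val % r', (Nat.mod_lt _ hr').trans_le hr⟩, p.2)
    bitTensor (Finset.univ.filter fun p => f p ∈ T) f a θ ∈ candidates n₁ n₂ n₃ r b s := by
  intro f
  -- The first factor lives on the frontal slice `0`, so its block circulant matrix is block
  -- diagonal and row `i` of the product is row `i % r'` of the second factor.
  refine ⟨fun p => if p.2.2.val = 0 ∧ p.2.1.val = p.1.val % r' then 1 else 0,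
    fun q => if q ∈ T ∧ θ q = true then a else 0, ?_, ?_, ?_, ?_⟩
  · funext p
    rw [tProd_apply, Finset.sum_eq_single (p.2.2, (f p).1)]
    · have h0 : (p.2.2 - p.2.2).val = 0 := (val_sub_eq_zero_iff _ _).2 rfl
      simp [bitTensor, h0, f]
    · intro q _ hq
      rw [if_neg, zero_mul]
      rintro ⟨h1, h2⟩
      exact hq (Prod.ext ((val_sub_eq_zero_iff _ _).1 h1) (Fin.ext h2))
    · simp
  · intro p
    dsimp only
    split_ifs <;> simp
  · intro p
    dsimp only
    split_ifs
    exacts [⟨ha, hab⟩, ⟨le_rfl, ha.trans hab⟩]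
  · refine le_trans (Finset.card_le_card fun q hq => ?_) hT
    by_contra h
    simp [h] at hq

/-- Bits placed in the first factor are displayed in a tensor product with a sparse second factor
that selects one column of the first factor for each of its first `q` columns. -/
lemma bitTensor_mem_candidates_left {q s : ℕ} {a b : ℝ} (hr : 0 < r) (hq : q ≤ s)
    (hn₃ : 0 < n₃) (ha : 0 ≤ a) (hab : a ≤ b) (θ : Idx n₁ r n₃ → Bool) :
    let f : Idx n₁ n₂ n₃ → Idx n₁ r n₃ := fun p => (p.1, ⟨p.2.1.val % r, Nat.mod_lt _ hr⟩, p.2.2)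
    bitTensor (Finset.univ.filter fun p : Idx n₁ n₂ n₃ => p.2.1.val < q) f a θ ∈
      candidates n₁ n₂ n₃ r b s := by
  intro f
  -- Here the second factor lives on the frontal slice `0`: column `j < q` of the product is `a`
  -- times column `j % r` of the first factor, and the other columns vanish.
  refine ⟨fun p => if θ p = true then 1 else 0,
    fun p => if p.2.2.val = 0 ∧ p.1.val = p.2.1.val % r ∧ p.2.1.val < q then a else 0,
    ?_, ?_, ?_, ?_⟩
  · funext p
    rw [tProd_apply, Finset.sum_eq_single (⟨0, hn₃⟩, (f p).2.1)]
    · have h0 : p.2.2 - ⟨0, hn₃⟩ = p.2.2 := sub_of_val_eq_zero _ _ rfl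
      simp only [bitTensor, h0, f]
      by_cases h : p.2.1.val < q <;> simp [h]
    · intro x _ hx
      rw [if_neg (c := _ ∧ _), mul_zero]
      rintro ⟨h1, h2, _⟩
      exact hx (Prod.ext (Fin.ext h1) (Fin.ext h2))
    · simp
  · intro p
    dsimp only
    split_ifs <;> simp
  · intro p
    dsimp only
    split_ifs
    exacts [⟨ha, hab⟩, ⟨le_rfl, ha.trans hab⟩]
  -- A nonzero entry of the second factor is determined by its column index `j < q`, so there are at
  -- most `q ≤ s` of them.
  · refine le_trans (Finset.card_le_card_of_injOn (t := Finset.range q)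
      (fun x => x.2.1.val) (fun x hx => ?_) fun x hx y hy hxy => ?_) (by simpa using hq)
    · by_contra h
      simp_all
    · have hmem (z : Idx r n₂ n₃) (hz : z ∈ ((Finset.univ.filter fun p : Idx r n₂ n₃ =>
          (if p.2.2.val = 0 ∧ p.1.val = p.2.1.val % r ∧ p.2.1.val < q then a else 0) ≠ 0) :
            Set (Idx r n₂ n₃))) : z.2.2.val = 0 ∧ z.1.val = z.2.1.val % r := by
        by_contra h
        simp only [Finset.coe_filter, Set.mem_ofPred_eq] at hz
        exact hz.2 (if_neg fun h' => h ⟨h'.1, h'.2.1⟩)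
      obtain ⟨hx1, hx2⟩ := hmem x hx
      obtain ⟨hy1, hy2⟩ := hmem y hy
      have hxy' : x.2.1.val = y.2.1.val := hxy
      refine Prod.ext (Fin.ext ?_) (Prod.ext (Fin.ext hxy') (Fin.ext ?_))
      · rw [hx2, hy2, hxy']
      · rw [hx1, hy1]

end TensorCompletion

/-! ### Counting displayed entries; the two halves of the bound -/

namespace TensorCompletion

variable {n₁ n₂ n₃ r : ℕ}

lemma card_filter_row_mod (r' : ℕ) (hr' : 0 < r') (hr : r' ≤ r) (d : Idx r n₂ n₃) :
    (Finset.univ.filter fun p : Idx n₁ n₂ n₃ =>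
      ((⟨p.1.val % r', (Nat.mod_lt _ hr').trans_le hr⟩, p.2) : Idx r n₂ n₃) = d).card =
      (Finset.univ.filter fun i : Fin n₁ => i.val % r' = d.1.val).card := by
  refine Finset.card_nbij Prod.fst (fun p hp => ?_) (fun p hp p' hp' h => ?_) fun i hi => ?_
  · simp only [Finset.coe_filter, Finset.mem_univ, true_and, Set.mem_ofPred_eq] at hp ⊢
    rw [← hp]
  · simp only [Finset.coe_filter, Finset.mem_univ, true_and, Set.mem_ofPred_eq] at hp hp'
    exact Prod.ext h ((congrArg Prod.snd hp).trans (congrArg Prod.snd hp').symm)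
  · simp only [Finset.coe_filter, Finset.mem_univ, true_and, Set.mem_ofPred_eq] at hi
    refine ⟨(i, d.2), ?_, rfl⟩
    simp only [Finset.coe_filter, Finset.mem_univ, true_and, Set.mem_ofPred_eq]
    exact Prod.ext (Fin.ext hi) rfl

lemma card_filter_fst_lt (r' : ℕ) (hr : r' ≤ r) :
    (Finset.univ.filter fun d : Idx r n₂ n₃ => d.1.val < r').card = r' * n₂ * n₃ := by
  have h : (Finset.univ.filter fun d : Idx r n₂ n₃ => d.1.val < r') =
      (Finset.univ.filter fun i : Fin r => i.val < r') ×ˢ Finset.univ := by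
    ext d; simp
  rw [h, Finset.card_product, Fin.card_filter_val_lt, min_eq_right hr]
  simp [mul_assoc]

lemma card_filter_snd_lt (q : ℕ) (hq : q ≤ n₂) :
    (Finset.univ.filter fun p : Idx n₁ n₂ n₃ => p.2.1.val < q).card = n₁ * (q * n₃) := by
  have h : (Finset.univ.filter fun p : Idx n₁ n₂ n₃ => p.2.1.val < q) =
      Finset.univ ×ˢ (Finset.univ.filter fun j : Fin n₂ => j.val < q) ×ˢ Finset.univ := by
    ext d; simp
  rw [h, Finset.card_product, Finset.card_product, Fin.card_filter_val_lt, min_eq_right hq]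
  simp

lemma card_filter_column_mod_le (q : ℕ) (hr : 0 < r) (d : Idx n₁ r n₃) :
    ((Finset.univ.filter fun p : Idx n₁ n₂ n₃ => p.2.1.val < q).filter fun p =>
      ((p.1, ⟨p.2.1.val % r, Nat.mod_lt _ hr⟩, p.2.2) : Idx n₁ r n₃) = d).card ≤
      (Finset.univ.filter fun j : Fin q => j.val % r = d.2.1.val).card := by
  rw [← Finset.card_map (Fin.valEmbedding)]
  refine Finset.card_le_card_of_injOn (fun p => p.2.1.val) (fun p hp => ?_)
    fun p hp p' hp' h => ?_
  · simp only [Finset.coe_filter, Finset.mem_filter, Finset.mem_univ, true_and,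
      Set.mem_ofPred_eq] at hp
    simp only [Finset.coe_map, Set.mem_image, Finset.coe_filter, Finset.mem_univ, true_and,
      Set.mem_ofPred_eq]
    exact ⟨⟨p.2.1.val, hp.1⟩, congrArg (fun d => d.2.1.val) hp.2, rfl⟩
  · simp only [Finset.coe_filter, Finset.mem_filter, Finset.mem_univ, true_and,
      Set.mem_ofPred_eq] at hp hp'
    have hd := hp.2.trans hp'.2.symm
    simp only [Prod.mk.injEq] at hd
    exact Prod.ext hd.1 (Prod.ext (Fin.ext h) hd.2.2)

variable {s m : ℕ} {b ν : ℝ} {Θ : Set ℝ} {P : ℝ → Measure ℝ} [∀ x, IsProbabilityMeasure (P x)]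

/-- The part of the minimax lower bound due to the sparse factor. -/
theorem le_minimaxRisk_candidates_right (hn₁ : 0 < n₁) (hn₂ : 0 < n₂) (hn₃ : 0 < n₃) (hs0 : 0 < s)
    (hr₁ : r ≤ n₁) (hs : s ≤ r * n₂ * n₃) (hm0 : 0 < m) (hm : m ≤ n₁ * n₂ * n₃) (hb : 0 ≤ b)
    (hν : 0 < ν) (hΘ : ∀ X ∈ candidates n₁ n₂ n₃ r b s, ∀ p, X p ∈ Θ)
    (hkl : ∀ x ∈ Θ, ∀ y ∈ Θ, InformationTheory.klDiv (P x) (P y) ≤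
      ENNReal.ofReal (1 / (2 * ν ^ 2) * (x - y) ^ 2)) :
    ENNReal.ofReal (min (min 1 ((s : ℝ) / ((n₂ : ℝ) * n₃)) * b ^ 2) (ν ^ 2 * (s / m)) / 128) ≤
      minimaxRisk P ((m : ℝ) / ((n₁ : ℝ) * n₂ * n₃)) (candidates n₁ n₂ n₃ r b s) := by
  have hN : 0 < n₁ * n₂ * n₃ := by positivity
  have hn₁' : (0 : ℝ) < n₁ := by exact_mod_cast hn₁
  have hn₂' : (0 : ℝ) < n₂ := by exact_mod_cast hn₂
  have hn₃' : (0 : ℝ) < n₃ := by exact_mod_cast hn₃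
  have hs0' : (0 : ℝ) < s := by exact_mod_cast hs0
  have hm0' : (0 : ℝ) < m := by exact_mod_cast hm0
  set Δ : ℝ := min 1 ((s : ℝ) / ((n₂ : ℝ) * n₃)) with hΔ
  -- `r' = ⌈s/(n₂n₃)⌉` is the least number of horizontal slices of the second factor with room for
  -- `s` bits; fewer slices mean more copies of each bit. If `s ≥ n₂n₃`, rounding up costs at most a
  -- factor two; otherwise `r' = 1` and `Δ = s/(n₂n₃)`.
  obtain ⟨r', hr'0, hr', hsr', hΔr'⟩ : ∃ r', 0 < r' ∧ r' ≤ r ∧ s ≤ r' * n₂ * n₃ ∧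
      Δ / 2 * (r' * n₂ * n₃) ≤ s := by
    have hx : 0 < (s : ℝ) / ((n₂ : ℝ) * n₃) := by positivity
    refine ⟨⌈(s : ℝ) / ((n₂ : ℝ) * n₃)⌉₊, Nat.ceil_pos.2 hx, Nat.ceil_le.2 ?_, ?_, ?_⟩
    · rw [div_le_iff₀ (by positivity), ← mul_assoc]
      exact_mod_cast hs
    · have h := Nat.le_ceil ((s : ℝ) / ((n₂ : ℝ) * n₃))
      rw [div_le_iff₀ (by positivity), ← mul_assoc] at h
      exact_mod_cast h
    · rw [mul_assoc _ (n₂ : ℝ), ← mul_assoc, ← le_div_iff₀ (by positivity)]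
      have h := (Nat.ceil_lt_add_one hx.le).le
      rcases le_total ((s : ℝ) / ((n₂ : ℝ) * n₃)) 1 with h1 | h1
      · have h2 : (⌈(s : ℝ) / ((n₂ : ℝ) * n₃)⌉₊ : ℝ) ≤ 1 := by
          exact_mod_cast Nat.ceil_le.2 (by simpa using h1)
        rw [hΔ, min_eq_right h1]
        nlinarith
      · rw [hΔ, min_eq_left h1]
        linarith
  have hr'' : (0 : ℝ) < r' := by exact_mod_cast hr'0
  obtain ⟨T, hTsub, hT⟩ := Finset.exists_subset_card_eq
    (s := Finset.univ.filter fun d : Idx r n₂ n₃ => d.1.val < r') (n := s)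
    (by rwa [card_filter_fst_lt r' hr'])
  set f : Idx n₁ n₂ n₃ → Idx r n₂ n₃ := fun p =>
    (⟨p.1.val % r', (Nat.mod_lt _ hr'0).trans_le hr'⟩, p.2)
  set S := Finset.univ.filter fun p => f p ∈ T with hS
  have hle : r' ≤ n₁ := hr'.trans hr₁
  -- Each of the `s` bits in `T` is displayed in at least `n₁/(2r')` entries.
  have hScard : (s : ℝ) * (n₁ / (2 * r')) ≤ S.card := by
    rw [Finset.card_eq_sum_card_fiberwise (f := f) (t := T) fun p hp => by simpa [hS] using hp,
      Nat.cast_sum, ← hT, ← nsmul_eq_mul]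
    refine Finset.card_nsmul_le_sum _ _ _ fun d hd => ?_
    have hd' : d.1.val < r' := by simpa using hTsub hd
    have h1 : (S.filter fun p => f p = d) = Finset.univ.filter fun p => f p = d := by
      ext p
      simp only [hS, Finset.mem_filter, Finset.mem_univ, true_and, and_iff_right_iff_imp]
      rintro rfl
      exact hd
    rw [h1, card_filter_row_mod r' hr'0 hr' d]
    exact le_card_filter_mod n₁ r' _ hr'0 hd' hle
  have hγ1 : (m : ℝ) / ((n₁ : ℝ) * n₂ * n₃) ≤ 1 := by
    rw [div_le_one (by positivity)]
    exact_mod_cast hm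
  refine ofReal_le_minimaxRisk_of_forall_le (b := b) (M := 2 * n₁ / r') S f hN (by positivity) hγ1
    hν hb hΘ hkl
    (fun a ha hab θ => bitTensor_mem_candidates_right hr'0 hr' T hT.le ha hab θ) (by positivity)
    (fun d => ?_) ?_ ?_
  · rcases lt_or_ge d.1.val r' with hd | hd
    · refine le_trans ?_ (card_filter_mod_le n₁ r' d.1.val hr'0 hd hle)
      rw [← card_filter_row_mod r' hr'0 hr' d]
      exact_mod_cast Finset.card_le_card (Finset.filter_subset_filter _ (Finset.subset_univ S))
    -- Slices from `r'` on are never copied, so their bits are displayed nowhere.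
    · rw [Finset.card_eq_zero.2 (Finset.filter_eq_empty_iff.2 fun p _ hp => ?_)]
      · simp only [Nat.cast_zero]
        positivity
      · rw [← hp] at hd
        exact absurd (Nat.mod_lt p.1.val hr'0) (not_lt.2 hd)
  -- Here `128 = 32 · 2 · 2`, from Assouad's constant, the count of copies and `Δ/2`. In the `ν`
  -- branch the last factor `2` comes from `M`.
  · calc min (Δ * b ^ 2) (ν ^ 2 * (s / m)) / 128 ≤ Δ * b ^ 2 / 128 := by
          gcongr
          exact min_le_left _ _
      _ = (Δ / 2 * (r' * n₂ * n₃)) * (n₁ / (2 * r')) * b ^ 2 / (32 * (n₁ * n₂ * n₃)) := by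
          field_simp
          ring
      _ ≤ s * (n₁ / (2 * r')) * b ^ 2 / (32 * (n₁ * n₂ * n₃)) := by gcongr
      _ ≤ _ := by gcongr
  · calc min (Δ * b ^ 2) (ν ^ 2 * (s / m)) / 128 ≤ ν ^ 2 * (s / m) / 128 := by
          gcongr
          exact min_le_right _ _
      _ = s * (n₁ / (2 * r')) * (ν ^ 2 / (m / (n₁ * n₂ * n₃) * (2 * n₁ / r'))) /
            (32 * (n₁ * n₂ * n₃)) := by
          field_simp
          ring
      _ ≤ _ := by gcongr

/-- The part of the minimax lower bound due to the dense factor. -/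
theorem le_minimaxRisk_candidates_left (hn₁ : 0 < n₁) (hn₂ : 0 < n₂) (hn₃ : 0 < n₃) (hr0 : 0 < r)
    (hr₂ : r ≤ n₂) (hrs : r ≤ s) (hm0 : 0 < m) (hm : m ≤ n₁ * n₂ * n₃) (hb : 0 ≤ b)
    (hν : 0 < ν) (hΘ : ∀ X ∈ candidates n₁ n₂ n₃ r b s, ∀ p, X p ∈ Θ)
    (hkl : ∀ x ∈ Θ, ∀ y ∈ Θ, InformationTheory.klDiv (P x) (P y) ≤
      ENNReal.ofReal (1 / (2 * ν ^ 2) * (x - y) ^ 2)) :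
    ENNReal.ofReal
        (min (min 1 ((s : ℝ) / ((n₂ : ℝ) * n₃)) * b ^ 2) (ν ^ 2 * (r * n₁ * n₃ / m)) / 64) ≤
      minimaxRisk P ((m : ℝ) / ((n₁ : ℝ) * n₂ * n₃)) (candidates n₁ n₂ n₃ r b s) := by
  have hN : 0 < n₁ * n₂ * n₃ := by positivity
  have hn₁' : (0 : ℝ) < n₁ := by exact_mod_cast hn₁
  have hn₂' : (0 : ℝ) < n₂ := by exact_mod_cast hn₂
  have hn₃' : (1 : ℝ) ≤ n₃ := by exact_mod_cast hn₃
  have hr0' : (0 : ℝ) < r := by exact_mod_cast hr0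
  have hm0' : (0 : ℝ) < m := by exact_mod_cast hm0
  set Δ : ℝ := min 1 ((s : ℝ) / ((n₂ : ℝ) * n₃)) with hΔ
  -- As many active columns as possible: each uses up one nonzero entry of the second factor, so the
  -- limits are `s` and `n₂`. Since `n₃ ≥ 1`, this is at least `Δn₂`.
  obtain ⟨q, hq⟩ : ∃ q, q = min s n₂ := ⟨_, rfl⟩
  have hqn : q ≤ n₂ := hq ▸ min_le_right _ _
  have hqs : q ≤ s := hq ▸ min_le_left _ _
  have hrq : r ≤ q := hq ▸ le_min hrs hr₂
  have hq0 : (0 : ℝ) < q := by exact_mod_cast hr0.trans_le hrq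
  have hΔq : Δ * n₂ ≤ q := by
    rw [hq, Nat.cast_min]
    refine le_min ?_ ?_
    · calc Δ * n₂ ≤ s / (n₂ * n₃) * n₂ := by gcongr; exact min_le_right _ _
        _ = s / n₃ := by field_simp
        _ ≤ s := div_le_self (by positivity) hn₃'
    · exact mul_le_of_le_one_left hn₂'.le (min_le_left _ _)
  have hγ1 : (m : ℝ) / ((n₁ : ℝ) * n₂ * n₃) ≤ 1 := by
    rw [div_le_one (by positivity)]
    exact_mod_cast hm
  refine ofReal_le_minimaxRisk_of_forall_le (b := b) (M := 2 * q / r)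
    (Finset.univ.filter fun p : Idx n₁ n₂ n₃ => p.2.1.val < q)
    (fun p => ((p.1, ⟨p.2.1.val % r, Nat.mod_lt _ hr0⟩, p.2.2) : Idx n₁ r n₃)) hN (by positivity)
    hγ1 hν hb hΘ hkl (fun a ha hab θ => bitTensor_mem_candidates_left hr0 hqs hn₃ ha hab θ)
    (by positivity) (fun d => ?_) ?_ ?_
  · refine le_trans ?_ (card_filter_mod_le q r d.2.1.val hr0 d.2.1.isLt hrq)
    exact_mod_cast card_filter_column_mod_le q hr0 d
  · rw [card_filter_snd_lt q hqn]
    push_cast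
    calc min (Δ * b ^ 2) (ν ^ 2 * (r * n₁ * n₃ / m)) / 64 ≤ Δ * b ^ 2 / 64 := by
          gcongr
          exact min_le_left _ _
      _ ≤ Δ * b ^ 2 / 32 := by gcongr; norm_num
      _ = n₁ * (Δ * n₂ * n₃) * b ^ 2 / (32 * (n₁ * n₂ * n₃)) := by field_simp
      _ ≤ _ := by gcongr
  · rw [card_filter_snd_lt q hqn]
    push_cast
    calc min (Δ * b ^ 2) (ν ^ 2 * (r * n₁ * n₃ / m)) / 64 ≤ ν ^ 2 * (r * n₁ * n₃ / m) / 64 := by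
          gcongr
          exact min_le_right _ _
      _ = _ := by
          field_simp
          ring

end TensorCompletion

/-! ### Combining the two halves -/

theorem theorem2 :
    ∃ C βc : ℝ, 0 < C ∧ 0 < βc ∧
      ∀ (n₁ n₂ n₃ r s m : ℕ) (b ν : ℝ) (Θ : Set ℝ) (P : ℝ → Measure ℝ)
        [∀ x, IsProbabilityMeasure (P x)],
        2 ≤ n₁ → 2 ≤ n₂ → 2 ≤ n₃ →
        r ≤ min n₁ n₂ → r ≤ s → s ≤ r * n₂ * n₃ →
        0 < m → m ≤ n₁ * n₂ * n₃ →
        0 ≤ b → 0 < ν →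
        (∀ X ∈ TensorCompletion.candidates n₁ n₂ n₃ r b s, ∀ p, X p ∈ Θ) →
        (∀ x ∈ Θ, ∀ y ∈ Θ,
          InformationTheory.klDiv (P x) (P y) ≤ ENNReal.ofReal (1 / (2 * ν ^ 2) * (x - y) ^ 2)) →
        ENNReal.ofReal
            (C * min (min 1 ((s : ℝ) / ((n₂ : ℝ) * n₃)) * b ^ 2)
              (βc ^ 2 * ν ^ 2 * (((s : ℝ) + (r : ℝ) * n₁ * n₃) / m))) ≤
          TensorCompletion.minimaxRisk P ((m : ℝ) / ((n₁ : ℝ) * n₂ * n₃))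
            (TensorCompletion.candidates n₁ n₂ n₃ r b s) := by
  -- `256 = 2 · 128`: the sum `s + rn₁n₃` is at most twice its larger term, and the half belonging
  -- to that term is applied.
  refine ⟨1 / 256, 1, by norm_num, by norm_num, ?_⟩
  intro n₁ n₂ n₃ r s m b ν Θ P _ hn₁ hn₂ hn₃ hr hrs hs hm0 hm hb hν hΘ hkl
  rcases Nat.eq_zero_or_pos r with rfl | hr0
  -- Without rank there are no nonzero entries, `Δ = 0`, and the bound is trivial.
  · obtain rfl : s = 0 := by simpa using hs
    simp
  have hs0 : 0 < s := hr0.trans_le hrs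
  have hright := TensorCompletion.le_minimaxRisk_candidates_right (by lia) (by lia) (by lia) hs0
    (hr.trans (min_le_left _ _)) hs hm0 hm hb hν hΘ hkl
  have hleft := TensorCompletion.le_minimaxRisk_candidates_left (by lia) (by lia) (by lia) hr0
    (hr.trans (min_le_right _ _)) hrs hm0 hm hb hν hΘ hkl
  have hΔ : 0 ≤ min 1 ((s : ℝ) / ((n₂ : ℝ) * n₃)) * b ^ 2 := by positivity
  generalize min 1 ((s : ℝ) / ((n₂ : ℝ) * n₃)) * b ^ 2 = B at *
  have hsplit {t : ℝ} (ht : (s : ℝ) + (r : ℝ) * n₁ * n₃ ≤ 2 * t) :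
      1 / 256 * min B (1 ^ 2 * ν ^ 2 * (((s : ℝ) + (r : ℝ) * n₁ * n₃) / m)) ≤
        min B (ν ^ 2 * (t / m)) / 128 := by
    have h : 1 ^ 2 * ν ^ 2 * (((s : ℝ) + (r : ℝ) * n₁ * n₃) / m) ≤ 2 * (ν ^ 2 * (t / m)) := by
      calc _ ≤ 1 ^ 2 * ν ^ 2 * (2 * t / m) := by gcongr
        _ = _ := by ring
    have h' : min B (1 ^ 2 * ν ^ 2 * (((s : ℝ) + (r : ℝ) * n₁ * n₃) / m)) ≤
        2 * min B (ν ^ 2 * (t / m)) := by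
      rw [mul_min_of_nonneg _ _ zero_le_two]
      exact min_le_min (by linarith) h
    linarith
  rcases le_total ((r : ℝ) * n₁ * n₃) s with h | h
  · exact (ENNReal.ofReal_le_ofReal (hsplit (by linarith))).trans hright
  · refine (ENNReal.ofReal_le_ofReal ((hsplit (t := r * n₁ * n₃) (by linarith)).trans ?_)).trans
      hleft
    have : 0 ≤ min B (ν ^ 2 * ((r : ℝ) * n₁ * n₃ / m)) := le_min hΔ (by positivity)
    linarith
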